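/- A space means a non-empty Tychonoff (completely regular $T_1$) space, and all topological groups are Hausdorff. A space is countably compact if each of its countable open covers has a finite subcover, and pseudocompact if every continuous real-valued function on it is bounded. For a space $X$ and a topological group $G$, $C_p(X,G)$ denotes the group of all continuous functions $X\to G$ with pointwise operations and the topology of pointwise convergence. The space $X$ is $G^\star$-regular if there is $g\in G\setminus\{e\}$ such that for every closed set $F\subseteq X$ and every $x\in X\setminus F$ some $f\in C_p(X,G)$ satisfies $f(x)=g$ and $f(F)\subseteq\{e\}$. A subset $A$ of $G$ is absolutely productive if for every injection $a:\mathbb{N}\to A$ and every map $z:\mathbb{N}\to\mathbb{Z}$ the sequence $\left(\prod_{n=0}^{k}a(n)^{z(n)}\right)_{k\in\mathbb{N}}$ converges to some element of $G$. The group $G$ is TAP if every absolutely productive subset of $G$ is finite, and precompact if it is topologically isomorphic to a subgroup of a compact group. Let $\mathbb{T}=\mathbb{R}/\mathbb{Z}$. Theorem. There exist a precompact TAP group $G$ and a countably compact $G^\star$-regular space $X$ such that $C_p(X,G)$ is not TAP. Moreover, these can be chosen so that $G\cong C_p(Y,\mathbb{T})$ (topologically isomorphic) for some pseudocompact space $Y$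 such that $X\times Y$ is not pseudocompact. -/

import Mathlib

open Topology Filter

/-- The circle group `ℝ / ℤ` with its quotient topology, written multiplicatively. -/
abbrev TorusGroup : Type := Multiplicative (AddCircle (1 : ℝ))

/-- `C_p(X, G)`: the group of continuous functions `X → G` under pointwise operations. Its
topology, inherited from the product `G ^ X`, is the topology of pointwise convergence. -/
abbrev Cp (X G : Type*) [TopologicalSpace X] [Group G] [TopologicalSpace G]
    [IsTopologicalGroup G] : Type _ :=
  ↥(continuousSubgroup X G)

/-- The sets `W(x, U) = {f | f x ∈ U}`, with `x` a point of `X` and `U` open in `G`, form a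
subbase of the topology of `C_p(X, G)`. -/
theorem Cp.topology_eq_generateFrom (X G : Type*) [TopologicalSpace X] [Group G]
    [TopologicalSpace G] [IsTopologicalGroup G] :
    (inferInstance : TopologicalSpace (Cp X G)) =
      TopologicalSpace.generateFrom
        {W | ∃ (x : X) (U : Set G), IsOpen U ∧ W = {f : Cp X G | f.1 x ∈ U}} := by
  apply le_antisymm
  · apply le_generateFrom
    rintro _ ⟨x, U, hU, rfl⟩
    exact hU.preimage ((continuous_apply x).comp continuous_subtype_val)
  · refine continuous_id_iff_le.1 ?_
    refine @Continuous.subtype_mk _ _ _ (_) _ _ ?_ _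
    refine @continuous_pi _ _ _ (_) _ _ fun x => ?_
    refine @Continuous.mk _ _ (_) _ _ fun U hU => ?_
    exact TopologicalSpace.isOpen_generateFrom_of_mem ⟨x, U, hU, rfl⟩

/-- Every continuous real-valued function is bounded. -/
def IsPseudocompactSpace (X : Type*) [TopologicalSpace X] : Prop :=
  ∀ f : X → ℝ, Continuous f → ∃ M : ℝ, ∀ x, |f x| ≤ M

/-- `G` is topologically isomorphic to a subgroup of a compact Hausdorff group. -/
def IsPrecompactGroup.{u} (G : Type u) [Group G] [TopologicalSpace G] : Prop :=
  ∃ (K : Type u) (_ : Group K) (_ : TopologicalSpace K),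
    IsTopologicalGroup K ∧ CompactSpace K ∧ T2Space K ∧ ∃ φ : G →* K, IsEmbedding φ

/-- `A` is absolutely productive in `G`: for every injection `a : ℕ → A` and every
`z : ℕ → ℤ`, the (ordered) partial products `a 0 ^ z 0 * ⋯ * a k ^ z k` converge in `G`. -/
def IsAbsolutelyProductive {G : Type*} [Group G] [TopologicalSpace G] (A : Set G) : Prop :=
  ∀ a : ℕ → G, Function.Injective a → (∀ n, a n ∈ A) → ∀ z : ℕ → ℤ,
    ∃ g : G, Tendsto (fun k : ℕ => ((List.range (k + 1)).map fun n => a n ^ z n).prod)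
      atTop (𝓝 g)

/-- A group is TAP if all its absolutely productive subsets are finite. -/
def IsTAP (G : Type*) [Group G] [TopologicalSpace G] : Prop :=
  ∀ A : Set G, IsAbsolutelyProductive A → A.Finite

/-- `X` is `G⋆`-regular: one `g ≠ 1` serves all closed sets `F` and points `x ∉ F`. -/
def IsStarRegular (X G : Type*) [TopologicalSpace X] [Group G] [TopologicalSpace G] : Prop :=
  ∃ g : G, g ≠ 1 ∧ ∀ F : Set X, IsClosed F → ∀ x ∉ F,
    ∃ f : X → G, Continuous f ∧ f x = g ∧ ∀ y ∈ F, f y = 1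

/-! Both spaces lie in `βℕ`. `X ⊇ ℕ` has at most continuum many points and contains a cluster point
of each of its sequences, so it is countably compact; `Y = ℕ ∪ (βℕ \ X)`, and `G = C_p(Y, 𝕋)`.
Continuum many ultrafilters do not exhaust those concentrated on an infinite subset of `ℕ`
(`exists_ultrafilter_map_notMem_range`), so every subsequence of the dense set `ℕ` clusters in `Y`.
This makes `Y` pseudocompact and, as `𝕋` has no small subgroups, `G` TAP (`isTAP_Cp_of_denseRange`).

Since `X ∩ Y = ℕ`, the diagonal `{(n, n)}` is closed in `X × Y` and consists of isolated points. It
therefore carries an unbounded continuous function. Any function supported on it is separately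
continuous, hence an element of `C_p(X, C_p(Y, 𝕋))`; those supported at single diagonal points form
an infinite absolutely productive set (`not_isTAP_Cp_Cp`). -/

/-! ### The circle group -/

theorem TorusGroup.exists_open_forall_exists_zpow_notMem :
    ∃ V : Set TorusGroup, IsOpen V ∧ (1 : TorusGroup) ∈ V ∧
      ∀ d : TorusGroup, d ≠ 1 → ∃ z : ℤ, d ^ z ∉ V := by
  refine ⟨{x | ‖x.toAdd‖ < 1 / 4}, isOpen_lt (continuous_norm.comp continuous_toAdd)
    continuous_const, by simp, fun d hd => ?_⟩
  obtain ⟨r, hr, hrn⟩ : ∃ r : ℝ, (r : AddCircle (1 : ℝ)) = d.toAdd ∧ |r| ≤ 1 / 2 := by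
    obtain ⟨r, hr⟩ := QuotientAddGroup.mk_surjective d.toAdd
    refine ⟨r - round r, ?_, abs_sub_round r⟩
    rw [← hr, AddCircle.coe_sub]
    have : ((round r : ℝ) : AddCircle (1 : ℝ)) = 0 :=
      (AddCircle.coe_eq_zero_iff (1 : ℝ)).2 ⟨round r, by simp⟩
    rw [this, sub_zero]
  have hr0 : r ≠ 0 := by
    rintro rfl
    exact hd (hr.symm : d.toAdd = 0)
  have hpos : 0 < |r| := abs_pos.2 hr0
  have key : ∀ n : ℕ, (n : ℝ) * |r| ≤ 1 / 2 → 1 / 4 ≤ (n : ℝ) * |r| →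
      ∃ z : ℤ, d ^ z ∉ {x : TorusGroup | ‖x.toAdd‖ < 1 / 4} := by
    intro n h1 h2
    refine ⟨n, ?_⟩
    have habs : |(n : ℝ) * r| = n * |r| := by rw [abs_mul, Nat.abs_cast]
    have hnorm : ‖(((n : ℝ) * r : ℝ) : AddCircle (1 : ℝ))‖ = |(n : ℝ) * r| := by
      exact (AddCircle.norm_coe_eq_abs_iff (1 : ℝ) one_ne_zero).2 (by rw [habs]; simpa using h1)
    have htoAdd : (d ^ (n : ℤ)).toAdd = (((n : ℝ) * r : ℝ) : AddCircle (1 : ℝ)) := by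
      rw [toAdd_zpow, ← hr, natCast_zsmul, ← AddCircle.coe_nsmul, nsmul_eq_mul]
    simp only [Set.mem_ofPred_eq, not_lt]
    rw [htoAdd, hnorm, habs]
    exact h2
  by_cases hq : 1 / 4 ≤ |r|
  · exact key 1 (by simpa using hrn) (by simpa using hq)
  -- Multiples of `r` advance by less than `1/4`, so one lands in `[1/4, 1/2]`, where the circle
  -- norm is still the absolute value.
  · push Not at hq
    refine key ⌈(1 / 4) / |r|⌉₊ ?_ ?_
    · have := (Nat.ceil_lt_add_one (a := (1 / 4) / |r|) (by positivity)).le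
      calc _ ≤ ((1 / 4) / |r| + 1) * |r| := by gcongr
        _ = 1 / 4 + |r| := by field_simp
        _ ≤ _ := by linarith
    · rw [← div_le_iff₀ hpos]
      exact Nat.le_ceil _

/-- If the coset `s⟨d⟩` stayed in a small `U`, its quotients `d ^ z` would stay in `V`. The factor
`s` will be the partial product built so far. -/
theorem TorusGroup.exists_open_forall_exists_mul_zpow_notMem :
    ∃ U : Set TorusGroup, IsOpen U ∧ (1 : TorusGroup) ∈ U ∧
      ∀ s d : TorusGroup, d ≠ 1 → ∃ z : ℤ, s * d ^ z ∉ U := by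
  obtain ⟨V, hVo, hV1, hV⟩ := TorusGroup.exists_open_forall_exists_zpow_notMem
  obtain ⟨U, hU, hUV⟩ := exists_nhds_split_inv (hVo.mem_nhds hV1)
  obtain ⟨W, hWU, hWo, hW1⟩ := mem_nhds_iff.1 hU
  refine ⟨W, hWo, hW1, fun s d hd => ?_⟩
  by_contra! h
  obtain ⟨z, hz⟩ := hV d hd
  apply hz
  have := hUV _ (hWU (h z)) _ (hWU (h 0))
  simpa [mul_comm s] using this

/-- Quotients of consecutive partial products tend to `1`, yet each nontrivial `a n` has a power
outside a fixed neighbourhood of `1`. -/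
theorem TorusGroup.eventually_eq_one_of_forall_tendsto (a : ℕ → TorusGroup)
    (h : ∀ z : ℕ → ℤ, ∃ g : TorusGroup,
      Tendsto (fun k : ℕ => ((List.range (k + 1)).map fun n => a n ^ z n).prod) atTop (𝓝 g)) :
    ∀ᶠ n in atTop, a n = 1 := by
  obtain ⟨V, hVo, hV1, hV⟩ := TorusGroup.exists_open_forall_exists_zpow_notMem
  choose! ζ hζ using hV
  obtain ⟨g, hg⟩ := h fun n => ζ (a n)
  have h2 := (hg.comp (tendsto_add_atTop_nat 1)).div' hg
  rw [div_self'] at h2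
  rw [← map_add_atTop_eq_nat 1, eventually_map]
  filter_upwards [h2.eventually_mem (hVo.mem_nhds hV1)] with n hn
  by_contra hne
  apply hζ _ hne
  simpa [List.prod_range_succ _ (n + 1)] using hn

/-! ### Spaces with a dense sequence all of whose subsequences cluster -/

theorem isPseudocompactSpace_of_denseRange {Y : Type*} [TopologicalSpace Y] {p : ℕ → Y}
    (hp : DenseRange p)
    (hc : ∀ m : ℕ → ℕ, Function.Injective m → ∃ y, MapClusterPt y atTop (p ∘ m)) :
    IsPseudocompactSpace Y := by
  intro f hf
  by_contra! hunb
  have hfreq : ∀ k : ℕ, ∃ᶠ n in atTop, (k : ℝ) < |f (p n)| := by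
    intro k hk
    simp only [not_lt] at hk
    obtain ⟨M, hM⟩ := IsBoundedUnder.bddAbove_range (f := fun n => |f (p n)|)
      (isBoundedUnder_of_eventually_le hk)
    obtain ⟨y, hy⟩ := hunb M
    obtain ⟨n, hn⟩ := hp.exists_mem_open (isOpen_lt continuous_const (hf.abs)) ⟨y, hy⟩
    exact (hM ⟨n, rfl⟩).not_gt hn
  obtain ⟨m, hm, hmk⟩ := extraction_forall_of_frequently hfreq
  obtain ⟨y, hy⟩ := hc m hm.injective
  have hU : {x | |f x| < |f y| + 1} ∈ 𝓝 y :=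
    (isOpen_lt hf.abs continuous_const).mem_nhds (by simp)
  obtain ⟨N, hN⟩ := exists_nat_gt (|f y| + 1)
  obtain ⟨k, hk, hNk⟩ := ((mapClusterPt_iff_frequently.1 hy _ hU).and_eventually
    (eventually_ge_atTop N)).exists
  have h1 := hmk k
  have h2 : (N : ℝ) ≤ k := by exact_mod_cast hNk
  simp only [Set.mem_ofPred_eq, Function.comp] at hk
  linarith

/-- Evaluation at a point, as a homomorphism. -/
def Cp.eval {X G : Type*} [TopologicalSpace X] [Group G] [TopologicalSpace G]
    [IsTopologicalGroup G] (x : X) : Cp X G →* G :=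
  (Pi.evalMonoidHom (fun _ : X => G) x).comp (continuousSubgroup X G).subtype

theorem Cp.continuous_eval {X G : Type*} [TopologicalSpace X] [Group G] [TopologicalSpace G]
    [IsTopologicalGroup G] (x : X) : Continuous (Cp.eval x : Cp X G → G) :=
  (continuous_apply x).comp continuous_subtype_val

theorem Cp.tendsto_iff {X G ι : Type*} [TopologicalSpace X] [Group G] [TopologicalSpace G]
    [IsTopologicalGroup G] {l : Filter ι} {F : ι → Cp X G} {f : Cp X G} :
    Tendsto F l (𝓝 f) ↔ ∀ x, Tendsto (fun i => Cp.eval x (F i)) l (𝓝 (Cp.eval x f)) := by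
  rw [tendsto_subtype_rng, tendsto_pi_nhds]
  rfl

/-- From an infinite absolutely productive set, extract functions `b j` and points of the dense
sequence such that `b j` is nontrivial at the `j`-th point and all later ones are trivial there.
Exponents chosen recursively keep the limit outside `U` at almost all these points, while it equals
`1` at a cluster point of them, against continuity. -/
theorem isTAP_Cp_of_denseRange {Y : Type*} [TopologicalSpace Y] {p : ℕ → Y}
    (hp : DenseRange p)
    (hc : ∀ m : ℕ → ℕ, Function.Injective m → ∃ y, MapClusterPt y atTop (p ∘ m)) :
    IsTAP (Cp Y TorusGroup) := by
  intro A hA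
  by_contra hinf
  have hinf' : (A \ {1}).Infinite := Set.Infinite.sdiff hinf (Set.finite_singleton 1)
  set a : ℕ → Cp Y TorusGroup := fun n => (hinf'.natEmbedding _ n).1
  have ainj : Function.Injective a :=
    Subtype.val_injective.comp (hinf'.natEmbedding _).injective
  have amem : ∀ n, a n ∈ A := fun n => (hinf'.natEmbedding _ n).2.1
  have ane : ∀ n, a n ≠ 1 := fun n => (hinf'.natEmbedding _ n).2.2
  have hev : ∀ b : ℕ → Cp Y TorusGroup, Function.Injective b → (∀ n, b n ∈ A) → ∀ y,
      ∀ᶠ n in atTop, Cp.eval y (b n) = 1 := by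
    intro b hb hbA y
    apply TorusGroup.eventually_eq_one_of_forall_tendsto
    intro z
    obtain ⟨g, hg⟩ := hA b hb hbA z
    refine ⟨Cp.eval y g, (((Cp.continuous_eval y).tendsto g).comp hg).congr fun k => ?_⟩
    simp [map_list_prod, List.map_map, Function.comp_def]
  have hne : ∀ n, ∃ m, Cp.eval (p m) (a n) ≠ 1 := by
    intro n
    by_contra! h
    apply ane n
    apply Subtype.ext
    exact hp.equalizer (a n).2 continuous_const (funext h)
  obtain ⟨s, hs1, hs2⟩ := exists_seq_of_forall_finset_exists
    -- A pair `(n, m)` stands for the function `a n` and the point `p m`.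
    (fun x : ℕ × ℕ => Cp.eval (p x.2) (a x.1) ≠ 1)
    (fun x x' => x.1 < x'.1 ∧ Cp.eval (p x.2) (a x'.1) = 1) (by
      intro F _
      have h1 : ∀ᶠ n in atTop, ∀ x ∈ F, x.1 < n ∧ Cp.eval (p x.2) (a n) = 1 :=
        (F.eventually_all).2 fun x _ =>
          (eventually_gt_atTop x.1).and (hev a ainj amem (p x.2))
      obtain ⟨n, hn⟩ := h1.exists
      obtain ⟨m, hm⟩ := hne n
      exact ⟨(n, m), hm, hn⟩)
  have minj : Function.Injective fun j => (s j).2 :=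
    .of_lt_imp_ne fun i j hij heq => by
      have := (hs2 i j hij).2
      replace heq : (s i).2 = (s j).2 := heq
      rw [heq] at this
      exact hs1 j this
  set b : ℕ → Cp Y TorusGroup := fun j => a (s j).1
  have binj : Function.Injective b :=
    ainj.comp (strictMono_nat_of_lt_succ fun j => (hs2 j (j + 1) j.lt_succ_self).1).injective
  obtain ⟨y, hy⟩ := hc _ minj
  obtain ⟨K, hK⟩ := eventually_atTop.1 (hev b binj (fun j => amem _) y)
  obtain ⟨U, hUo, hU1, hU⟩ := TorusGroup.exists_open_forall_exists_mul_zpow_notMem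
  choose! ζ hζ using hU
  -- The first `K` factors are dropped because they may be nontrivial at `y`. Later exponents depend
  -- on the product `f` of the preceding factors.
  let e : ℕ → Cp Y TorusGroup → ℤ := fun j f =>
    if j < K then 0 else ζ (Cp.eval (p (s j).2) f) (Cp.eval (p (s j).2) (b j))
  let S : ℕ → Cp Y TorusGroup := fun n => Nat.rec 1 (fun j f => f * b j ^ e j f) n
  have hS : ∀ j, S (j + 1) = S j * b j ^ e j (S j) := fun j => rfl
  have hSprod : ∀ k, ((List.range k).map fun n => b n ^ e n (S n)).prod = S k := by
    intro k
    induction k with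
    | zero => rfl
    | succ k ih => rw [List.prod_range_succ, ih, hS]
  obtain ⟨f, hf⟩ := hA b binj (fun j => amem _) fun n => e n (S n)
  simp only [hSprod] at hf
  rw [Cp.tendsto_iff] at hf
  have hSy : ∀ k, Cp.eval y (S k) = 1 := by
    intro k
    induction k with
    | zero => exact map_one _
    | succ k ih =>
      rw [hS, map_mul, map_zpow, ih, one_mul]
      by_cases hk : k < K
      · simp [e, hk]
      · rw [hK k (not_lt.1 hk), one_zpow]
  have hfy : f.1 y = 1 := by
    have := hf y
    simp only [hSy] at this
    exact tendsto_nhds_unique this tendsto_const_nhds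
  have hSm : ∀ j k, j < k → Cp.eval (p (s j).2) (S k) = Cp.eval (p (s j).2) (S (j + 1)) := by
    intro j k hjk
    induction k, hjk using Nat.le_induction with
    | base => rfl
    | succ k hjk ih =>
      rw [hS, map_mul, map_zpow, (hs2 j k hjk).2, one_zpow, mul_one, ih]
  have hfm : ∀ j, f.1 (p (s j).2) = Cp.eval (p (s j).2) (S (j + 1)) := by
    intro j
    refine tendsto_nhds_unique (hf (p (s j).2)) (tendsto_const_nhds.congr' ?_)
    filter_upwards [eventually_ge_atTop j] with k hk
    exact (hSm j (k + 1) (Nat.lt_succ_of_le hk)).symm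
  have hfU : f.1 ⁻¹' U ∈ 𝓝 y := (hUo.preimage f.2).mem_nhds (by simpa [hfy] using hU1)
  obtain ⟨j, hj, hKj⟩ := ((mapClusterPt_iff_frequently.1 hy _ hfU).and_eventually
    (eventually_ge_atTop K)).exists
  have hj' : f.1 (p (s j).2) ∈ U := hj
  rw [hfm, hS, map_mul, map_zpow] at hj'
  simp only [e, if_neg (not_lt.2 hKj)] at hj'
  exact hζ _ _ (hs1 j) hj'

/-! ### Functions on a product supported on a discrete diagonal -/

theorem continuous_of_forall_ne_eq {Y Z : Type*} [TopologicalSpace Y] [T1Space Y]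
    [TopologicalSpace Z] {f : Y → Z} {y₀ : Y} (ho : IsOpen {y₀}) {c : Z}
    (h : ∀ y, y ≠ y₀ → f y = c) : Continuous f := by
  rw [continuous_iff_continuousAt]
  intro y
  by_cases hy : y = y₀
  · subst hy
    rw [ContinuousAt, (isOpen_singleton_iff_nhds_eq_pure _).1 ho]
    exact tendsto_pure_nhds f y
  · refine (continuousAt_const (y := c)).congr ?_
    filter_upwards [isOpen_compl_singleton.mem_nhds hy] with x hx
    exact (h x hx).symm

open Classical in
/-- The function with the value `c n` at `(p n, q n)` and `1` elsewhere. -/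
noncomputable def diagFun {X Y G : Type*} [One G] (p : ℕ → X) (q : ℕ → Y) (c : ℕ → G)
    (x : X) (y : Y) : G :=
  if h : ∃ n, x = p n ∧ y = q n then c h.choose else 1

theorem diagFun_apply {X Y G : Type*} [One G] {p : ℕ → X} (hp : Function.Injective p)
    (q : ℕ → Y) (c : ℕ → G) (n : ℕ) : diagFun p q c (p n) (q n) = c n := by
  have h : ∃ m, p n = p m ∧ q n = q m := ⟨n, rfl, rfl⟩
  rw [diagFun, dif_pos h, hp h.choose_spec.1.symm]

theorem diagFun_of_forall_ne {X Y G : Type*} [One G] (p : ℕ → X) (q : ℕ → Y) (c : ℕ → G)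
    {x : X} {y : Y} (h : ∀ n, x = p n → y ≠ q n) : diagFun p q c x y = 1 :=
  dif_neg fun ⟨n, hx, hy⟩ => h n hx hy

theorem continuous_diagFun_right {X Y G : Type*} [TopologicalSpace Y] [T1Space Y] [One G]
    [TopologicalSpace G] {p : ℕ → X} {q : ℕ → Y} (hp : Function.Injective p)
    (hqo : ∀ n, IsOpen {q n}) (c : ℕ → G) (x : X) : Continuous (diagFun p q c x) := by
  by_cases h : ∃ n, x = p n
  · obtain ⟨n, rfl⟩ := h
    refine continuous_of_forall_ne_eq (hqo n) (c := 1) fun y hy => ?_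
    refine diagFun_of_forall_ne p q c fun m hm => ?_
    rwa [← hp hm]
  · refine continuous_const.congr (f := fun _ => 1) fun y => ?_
    exact (diagFun_of_forall_ne p q c fun n hn => (h ⟨n, hn⟩).elim).symm

theorem continuous_diagFun_left {X Y G : Type*} [TopologicalSpace X] [T1Space X] [One G]
    [TopologicalSpace G] {p : ℕ → X} {q : ℕ → Y} (hq : Function.Injective q)
    (hpo : ∀ n, IsOpen {p n}) (c : ℕ → G) (y : Y) :
    Continuous fun x => diagFun p q c x y := by
  by_cases h : ∃ n, y = q n
  · obtain ⟨n, rfl⟩ := h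
    refine continuous_of_forall_ne_eq (hpo n) (c := 1) fun x hx => ?_
    refine diagFun_of_forall_ne p q c fun m hm hm' => ?_
    rw [hq hm'] at hx
    exact hx hm
  · refine continuous_const.congr (f := fun _ => 1) fun x => ?_
    exact (diagFun_of_forall_ne p q c fun n _ hn => h ⟨n, hn⟩).symm

/-- Under the topology of pointwise convergence on `C_p(Y, G)`, separate continuity suffices. Each
section has at most one exceptional value, taken at an isolated point. -/
theorem exists_Cp_Cp_eval_eq_diagFun {X Y G : Type*} [TopologicalSpace X] [TopologicalSpace Y]
    [T1Space X] [T1Space Y] [Group G] [TopologicalSpace G] [IsTopologicalGroup G]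
    {p : ℕ → X} {q : ℕ → Y} (hp : Function.Injective p) (hq : Function.Injective q)
    (hpo : ∀ n, IsOpen {p n}) (hqo : ∀ n, IsOpen {q n}) (c : ℕ → G) :
    ∃ f : Cp X (Cp Y G), ∀ x y, Cp.eval y (Cp.eval x f) = diagFun p q c x y :=
  ⟨⟨fun x => ⟨diagFun p q c x, continuous_diagFun_right hp hqo c x⟩,
    Continuous.subtype_mk (continuous_pi fun y => continuous_diagFun_left hq hpo c y) _⟩,
    fun _ _ => rfl⟩

/-- At each `(x, y)` at most one factor of a product of the `h n` is nontrivial, so partial products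
are eventually constant there, whatever the exponents. -/
theorem not_isTAP_Cp_Cp {X Y G : Type*} [TopologicalSpace X] [TopologicalSpace Y]
    [T1Space X] [T1Space Y] [CommGroup G] [TopologicalSpace G] [IsTopologicalGroup G]
    [Nontrivial G] {p : ℕ → X} {q : ℕ → Y} (hp : Function.Injective p)
    (hq : Function.Injective q) (hpo : ∀ n, IsOpen {p n}) (hqo : ∀ n, IsOpen {q n}) :
    ¬ IsTAP (Cp X (Cp Y G)) := by
  obtain ⟨g, hg⟩ := exists_ne (1 : G)
  choose D hD using fun c : ℕ → G => exists_Cp_Cp_eval_eq_diagFun hp hq hpo hqo c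
  let h : ℕ → Cp X (Cp Y G) := fun n => D (Pi.mulSingle n g)
  have hinj : Function.Injective h := by
    intro n m hnm
    by_contra hne
    have := congrArg (fun f => Cp.eval (q n) (Cp.eval (p n) f)) hnm
    simp only [h, hD, diagFun_apply hp, Pi.mulSingle_eq_same, Pi.mulSingle_eq_of_ne hne] at this
    exact hg this
  intro hTAP
  refine Set.infinite_range_of_injective hinj (hTAP _ ?_)
  intro a ha haA z
  choose σ hσ using haA
  have σinj : Function.Injective σ := fun n m hnm => ha (by rw [← hσ, ← hσ, hnm])
  obtain ⟨f, hf⟩ := exists_Cp_Cp_eval_eq_diagFun (hp.comp σinj) (hq.comp σinj)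
    (fun n => hpo _) (fun n => hqo _) (fun n => g ^ z n)
  refine ⟨f, Cp.tendsto_iff.2 fun x => Cp.tendsto_iff.2 fun y => ?_⟩
  have hprod : ∀ k, Cp.eval y (Cp.eval x ((List.range (k + 1)).map fun n => a n ^ z n).prod) =
      ∏ n ∈ Finset.range (k + 1), diagFun p q (Pi.mulSingle (σ n) g) x y ^ z n := by
    intro k
    simp only [map_list_prod, List.map_map, Function.comp_def, map_zpow, ← hσ, h, hD]
    rfl
  simp only [hprod, hf]
  by_cases hxy : ∃ n, x = p (σ n) ∧ y = q (σ n)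
  · obtain ⟨n, rfl, rfl⟩ := hxy
    rw [show diagFun (p ∘ σ) (q ∘ σ) (fun n => g ^ z n) (p (σ n)) (q (σ n)) = g ^ z n from
      diagFun_apply (hp.comp σinj) (q ∘ σ) _ n]
    refine tendsto_const_nhds.congr' ?_
    filter_upwards [eventually_ge_atTop n] with k hk
    simp only [diagFun_apply hp]
    rw [Finset.prod_eq_single n]
    · simp
    · intro m _ hm
      rw [Pi.mulSingle_eq_of_ne (fun h => hm (σinj h.symm)), one_zpow]
    · intro hn
      exact (hn (Finset.mem_range.2 (Nat.lt_succ_of_le hk))).elim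
  · rw [diagFun_of_forall_ne (p ∘ σ) (q ∘ σ) _ fun n hx hy => hxy ⟨n, hx, hy⟩]
    refine tendsto_const_nhds.congr fun k => (Finset.prod_eq_one fun n _ => ?_).symm
    have : diagFun p q (Pi.mulSingle (σ n) g) x y = 1 := by
      -- The point may still be on the diagonal, at an index that `σ` misses.
      by_cases hm : ∃ m, x = p m ∧ y = q m
      · obtain ⟨m, rfl, rfl⟩ := hm
        rw [diagFun_apply hp]
        refine Pi.mulSingle_eq_of_ne (fun h => hxy ⟨n, ?_⟩) _
        rw [h]
        exact ⟨rfl, rfl⟩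
      · exact diagFun_of_forall_ne p q _ fun m hx hy => hm ⟨m, hx, hy⟩
    rw [this, one_zpow]

/-- The unbounded function has value `n` at `(p n, q n)`. These points are isolated, and off them `i
x ≠ j y` is an open condition on which it is constant. -/
theorem not_isPseudocompactSpace_prod {X Y Z : Type*} [TopologicalSpace X] [TopologicalSpace Y]
    [TopologicalSpace Z] [T2Space Z] {i : X → Z} {j : Y → Z} (hi : Continuous i)
    (hj : Continuous j) {p : ℕ → X} {q : ℕ → Y} (hp : Function.Injective p)
    (hpo : ∀ n, IsOpen {p n}) (hqo : ∀ n, IsOpen {q n})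
    (hpq : ∀ x y, i x = j y ↔ ∃ n, x = p n ∧ y = q n) : ¬ IsPseudocompactSpace (X × Y) := by
  intro h
  have hcont : Continuous fun w : X × Y => diagFun p q (fun n => (n : ℝ)) w.1 w.2 := by
    rw [continuous_iff_continuousAt]
    rintro ⟨x, y⟩
    by_cases hxy : i x = j y
    · obtain ⟨n, rfl, rfl⟩ := (hpq x y).1 hxy
      have ho : IsOpen {(p n, q n)} := by
        rw [← Set.singleton_prod_singleton]
        exact (hpo n).prod (hqo n)
      rw [ContinuousAt, (isOpen_singleton_iff_nhds_eq_pure _).1 ho]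
      exact tendsto_pure_nhds _ _
    · refine (continuousAt_const (y := 1)).congr ?_
      have hne : IsOpen {w : X × Y | i w.1 ≠ j w.2} :=
        isOpen_ne_fun (hi.comp continuous_fst) (hj.comp continuous_snd)
      filter_upwards [hne.mem_nhds hxy] with w hw
      exact (diagFun_of_forall_ne p q _ fun n hx hy => hw ((hpq _ _).2 ⟨n, hx, hy⟩)).symm
  obtain ⟨M, hM⟩ := h _ hcont
  obtain ⟨n, hn⟩ := exists_nat_gt M
  have := hM (p n, q n)
  rw [diagFun_apply hp, Nat.abs_cast] at this
  linarith

theorem isPrecompactGroup_Cp.{u} {Y G : Type u} [TopologicalSpace Y] [Group G]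
    [TopologicalSpace G] [IsTopologicalGroup G] [CompactSpace G] [T2Space G] :
    IsPrecompactGroup (Cp Y G) :=
  ⟨Y → G, inferInstance, inferInstance, inferInstance, inferInstance, inferInstance,
    (continuousSubgroup Y G).subtype, IsEmbedding.subtypeVal⟩

/-! ### Two subspaces of the space of ultrafilters on `ℕ` -/

/-- Hausdorff's construction: code `ℕ` as pairs (finite family of finite sets, `n`), and let `B r`
hold when the truncation of `r` below `n` is in the family. For large `n` truncation separates any
finitely many sets, so the family can prescribe membership freely. -/
theorem exists_independent_family :
    ∃ B : Set ℕ → Set ℕ, ∀ (s : Finset (Set ℕ)) (σ : Set (Set ℕ)),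
      ∃ n, ∀ r ∈ s, (n ∈ B r ↔ r ∈ σ) := by
  classical
  let e : ℕ ≃ Finset (Finset ℕ) × ℕ := (Denumerable.eqv _).symm
  let t : ℕ → Set ℕ → Finset ℕ := fun n r => (Finset.range n).filter (· ∈ r)
  refine ⟨fun r => {n | t (e n).2 r ∈ (e n).1}, fun s σ => ?_⟩
  have hsep : ∀ᶠ n in atTop, ∀ r ∈ s, ∀ r' ∈ s, t n r = t n r' → r = r' := by
    simp only [Finset.eventually_all]
    intro r _ r' _
    by_cases h : r = r'
    · exact .of_forall fun _ _ => h
    · obtain ⟨k, hk⟩ : ∃ k, ¬ (k ∈ r ↔ k ∈ r') := by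
        by_contra! h'
        exact h (Set.ext h')
      filter_upwards [eventually_gt_atTop k] with n hn heq
      have := Finset.ext_iff.1 heq k
      simp only [t, Finset.mem_filter, Finset.mem_range, hn, true_and] at this
      exact (hk this).elim
  obtain ⟨n, hn⟩ := hsep.exists
  refine ⟨e.symm ((s.filter (· ∈ σ)).image (t n), n), fun r hr => ?_⟩
  simp only [Set.mem_ofPred_eq, Equiv.apply_symm_apply, Finset.mem_image, Finset.mem_filter]
  constructor
  · rintro ⟨r', ⟨hr', hσ⟩, heq⟩
    rwa [← hn r' hr' r hr heq]
  · exact fun hσ => ⟨r, ⟨hr, hσ⟩, rfl⟩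

/-- The ultrafilters containing the range of `φ` are not exhausted by a family indexed by the
continuum. -/
theorem exists_ultrafilter_map_notMem_range (E : Set ℕ → Ultrafilter ℕ) {φ : ℕ → ℕ}
    (hφ : Function.Injective φ) : ∃ u : Ultrafilter ℕ, u.map φ ∉ Set.range E := by
  classical
  obtain ⟨B, hB⟩ := exists_independent_family
  -- Diagonalization: `u` is made to contain `B r` exactly when `E r` does not contain its image, so
  -- `u.map φ` differs from every `E r`.
  let σ : Set (Set ℕ) := {r | φ '' B r ∉ E r}
  let C : Set ℕ → Set ℕ := fun r => {n | n ∈ B r ↔ r ∈ σ}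
  obtain ⟨u, hu⟩ := Ultrafilter.exists_ultrafilter_of_finite_inter_nonempty (Set.range C) (by
    intro T hT
    obtain ⟨s, -, hs⟩ := Finset.subset_set_image_iff.1 (by rwa [Set.image_univ] : ↑T ⊆ C '' .univ)
    obtain ⟨n, hn⟩ := hB s σ
    refine ⟨n, ?_⟩
    rw [← hs]
    simpa [C] using hn)
  refine ⟨u, ?_⟩
  rintro ⟨r, hr⟩
  have h1 : C r ∈ u := hu ⟨r, rfl⟩
  have h2 : φ '' B r ∈ E r ↔ B r ∈ u := by
    rw [hr, Ultrafilter.mem_map, hφ.preimage_image]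
  by_cases hσ : r ∈ σ
  · exact hσ (h2.2 (mem_of_superset h1 fun n hn => hn.2 hσ))
  · refine (u.compl_mem_iff_notMem.1 (mem_of_superset h1 fun n hn hnB => hσ (hn.1 hnB)))
      (h2.1 (not_not.1 hσ))

/-- The type of children of a node of a tree: leaves are labelled by natural numbers, all other
nodes have a sequence of children. -/
abbrev CountableTreeChild : Option ℕ → Type
  | none => ℕ
  | some _ => Empty

/-- There are countably many node labels, and `𝔠 ^ ℵ₀ = 𝔠`. -/
theorem mk_wtype_countableTreeChild_le :
    Cardinal.mk (WType CountableTreeChild) ≤ Cardinal.continuum := by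
  apply WType.cardinalMk_le_of_le'
  refine (Cardinal.sum_le_sum _ (fun _ => Cardinal.continuum) ?_).trans ?_
  · rintro (_ | n)
    · simp [CountableTreeChild]
    · simpa [CountableTreeChild] using (Cardinal.nat_lt_continuum 1).le
  · simp

/-- A sequence in a compact space lies in a subset of cardinality at most the continuum that
contains a cluster point of each of its sequences. -/
theorem exists_range_forall_mapClusterPt {Z : Type*} [TopologicalSpace Z] [CompactSpace Z]
    (p : ℕ → Z) : ∃ E : Set ℕ → Z, (∀ n, p n ∈ Set.range E) ∧
      ∀ s : ℕ → Z, (∀ n, s n ∈ Set.range E) → ∃ z ∈ Set.range E, MapClusterPt z atTop s := by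
  have hcl : ∀ s : ℕ → Z, ∃ z, MapClusterPt z atTop s := fun s => exists_clusterPt_of_compactSpace _
  choose L hL using hcl
  -- Well-founded trees replace transfinite closure under `L`: a leaf names a term of `p`, and a
  -- branching node names the chosen cluster point of its children's values.
  let step : (Σ o, CountableTreeChild o → Z) → Z := fun w =>
    match w with
    | ⟨none, f⟩ => L f
    | ⟨some n, _⟩ => p n
  let ev : WType CountableTreeChild → Z := WType.elim Z step
  have : Nonempty (WType CountableTreeChild) := ⟨⟨some 0, Empty.elim⟩⟩
  obtain ⟨ι⟩ : Nonempty (WType CountableTreeChild ↪ Set ℕ) := by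
    rw [← Cardinal.le_def, Cardinal.mk_set_nat]
    exact mk_wtype_countableTreeChild_le
  have hrange : Set.range (ev ∘ Function.invFun ι) = Set.range ev :=
    (Function.invFun_surjective ι.injective).range_comp ev
  refine ⟨ev ∘ Function.invFun ι, ?_, ?_⟩
  · rw [hrange]
    exact fun n => ⟨⟨some n, Empty.elim⟩, rfl⟩
  · rw [hrange]
    intro s hs
    choose t ht using hs
    refine ⟨_, ⟨⟨none, t⟩, rfl⟩, ?_⟩
    have : ev ⟨none, t⟩ = L s := congrArg L (funext ht)
    rw [this]
    exact hL s

theorem isOpen_singleton_of_val_eq_pure {S : Set (Ultrafilter ℕ)} {x : S} {n : ℕ}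
    (hx : x.1 = pure n) : IsOpen {x} := by
  convert (ultrafilter_isOpen_basic {n}).preimage (continuous_subtype_val (p := (· ∈ S))) using 1
  ext u
  rw [Set.mem_singleton_iff, Subtype.ext_iff, hx]
  constructor
  · intro h
    simp [h]
  · intro h
    obtain ⟨m, rfl, hm⟩ := Ultrafilter.eq_pure_of_finite_mem (Set.finite_singleton n) h
    exact hm

/-- The ultrafilter space is zero-dimensional, so a two-valued function on a clopen partition
separates `x` from `F`. -/
theorem isStarRegular_of_subset_ultrafilter (S : Set (Ultrafilter ℕ)) (G : Type*) [Group G]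
    [TopologicalSpace G] [Nontrivial G] : IsStarRegular S G := by
  classical
  obtain ⟨g, hg⟩ := exists_ne (1 : G)
  refine ⟨g, hg, fun F hF x hx => ?_⟩
  obtain ⟨O, hO, hOF⟩ := isOpen_induced_iff.1 hF.isOpen_compl
  have hxO : x.1 ∈ O := by
    have : x ∈ Subtype.val ⁻¹' O := by rw [hOF]; exact hx
    exact this
  obtain ⟨V, hV, hxV, hVO⟩ := compact_exists_isClopen_in_isOpen hO hxO
  have hW : IsClopen (Subtype.val ⁻¹' V : Set S) := hV.preimage continuous_subtype_val
  refine ⟨(Subtype.val ⁻¹' V).piecewise (fun _ => g) fun _ => 1, ?_, ?_, ?_⟩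
  · refine continuous_const.piecewise ?_ continuous_const
    simp [hW.frontier_eq]
  · exact Set.piecewise_eq_of_mem _ _ _ hxV
  · intro y hy
    refine Set.piecewise_eq_of_notMem _ _ _ fun hyV => ?_
    have : y ∈ Fᶜ := by rw [← hOF]; exact hVO hyV
    exact this hy

/-! ### The example. -/

theorem mainTheorem7 :
    ∃ (X : Type) (_ : TopologicalSpace X) (Y : Type) (_ : TopologicalSpace Y)
      (G : Type) (_ : Group G) (_ : TopologicalSpace G) (_ : IsTopologicalGroup G),
      (Nonempty X ∧ T35Space X ∧ CountablyCompactSpace X) ∧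
      (Nonempty Y ∧ T35Space Y ∧ IsPseudocompactSpace Y) ∧
      ¬ IsPseudocompactSpace (X × Y) ∧
      Nonempty (G ≃ₜ* Cp Y TorusGroup) ∧
      T2Space G ∧ IsPrecompactGroup G ∧ IsTAP G ∧
      IsStarRegular X G ∧
      ¬ IsTAP (Cp X G) := by
  obtain ⟨E, hpure, hE⟩ := exists_range_forall_mapClusterPt (pure : ℕ → Ultrafilter ℕ)
  let X : Set (Ultrafilter ℕ) := Set.range E
  let Y : Set (Ultrafilter ℕ) := Set.range pure ∪ Xᶜ
  let p : ℕ → X := fun n => ⟨pure n, hpure n⟩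
  let q : ℕ → Y := fun n => ⟨pure n, Or.inl ⟨n, rfl⟩⟩
  have hp : Function.Injective p := fun m n h =>
    Ultrafilter.pure_injective (congrArg Subtype.val h)
  have hq : Function.Injective q := fun m n h =>
    Ultrafilter.pure_injective (congrArg Subtype.val h)
  have hpo : ∀ n, IsOpen {p n} := fun n => isOpen_singleton_of_val_eq_pure rfl
  have hqo : ∀ n, IsOpen {q n} := fun n => isOpen_singleton_of_val_eq_pure rfl
  have hqd : DenseRange q := by
    rw [DenseRange, dense_iff_inter_open]
    rintro W hW ⟨y, hy⟩
    obtain ⟨O, hO, rfl⟩ := isOpen_induced_iff.1 hW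
    obtain ⟨n, hn⟩ := denseRange_pure.exists_mem_open hO ⟨y.1, hy⟩
    exact ⟨q n, hn, n, rfl⟩
  have hqc : ∀ m : ℕ → ℕ, Function.Injective m → ∃ y, MapClusterPt y atTop (q ∘ m) := by
    intro m hm
    obtain ⟨u, hu⟩ := exists_ultrafilter_map_notMem_range E hm
    -- `u` is free: a principal `u` would have a principal image, which lies in `X`.
    have hle : (u : Filter ℕ) ≤ atTop := by
      rw [← Nat.cofinite_eq_atTop]
      refine u.le_cofinite_or_eq_pure.resolve_right ?_
      rintro ⟨n, rfl⟩
      exact hu (by simpa using hpure (m n))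
    have hlim : Tendsto (pure ∘ m) u (𝓝 (u.map m)) :=
      (Ultrafilter.tendsto_pure_self (u.map m)).comp (tendsto_map : Tendsto m u (u.map m))
    have huY : u.map m ∈ Y := Or.inr hu
    have hclust : MapClusterPt (u.map m) atTop (pure ∘ m) := hlim.mapClusterPt.mono hle
    exact ⟨⟨u.map m, huY⟩, IsInducing.subtypeVal.mapClusterPt_iff.1 hclust⟩
  have hXc : CountablyCompactSpace X := by
    refine ⟨isCountablyCompact_iff_seq_clusterPt.2 fun s _ => ?_⟩
    obtain ⟨z, hz, hzs⟩ := hE (fun n => (s n).1) fun n => (s n).2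
    exact ⟨⟨z, hz⟩, trivial, IsInducing.subtypeVal.mapClusterPt_iff.1 hzs⟩
  have hpq : ∀ (x : X) (y : Y), x.1 = y.1 ↔ ∃ n, x = p n ∧ y = q n := by
    intro x y
    constructor
    · intro h
      rcases y.2 with ⟨n, hn⟩ | hy
      · exact ⟨n, Subtype.ext (h.trans hn.symm), Subtype.ext hn.symm⟩
      · exact (hy (h ▸ x.2)).elim
    · rintro ⟨n, rfl, rfl⟩
      rfl
  have : Nontrivial TorusGroup := by
    refine ⟨.ofAdd ((1 / 2 : ℝ) : AddCircle (1 : ℝ)), 1, fun h => ?_⟩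
    obtain ⟨n, hn⟩ := (AddCircle.coe_eq_zero_iff (1 : ℝ)).1 (congrArg Multiplicative.toAdd h)
    rw [zsmul_eq_mul, mul_one] at hn
    have h2 : (2 * n : ℤ) = 1 := by
      have : (2 : ℝ) * n = 1 := by linarith
      exact_mod_cast this
    omega
  have : Nontrivial (Cp Y TorusGroup) := by
    obtain ⟨g, hg⟩ := exists_ne (1 : TorusGroup)
    exact ⟨⟨fun _ => g, continuous_const⟩, 1, fun h => hg (congrArg (Cp.eval (q 0)) h)⟩
  exact ⟨X, inferInstance, Y, inferInstance, Cp Y TorusGroup, inferInstance, inferInstance,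
    inferInstance, ⟨⟨p 0⟩, inferInstance, hXc⟩,
    ⟨⟨q 0⟩, inferInstance, isPseudocompactSpace_of_denseRange hqd hqc⟩,
    not_isPseudocompactSpace_prod continuous_subtype_val continuous_subtype_val hp hpo hqo hpq,
    ⟨ContinuousMulEquiv.refl _⟩, inferInstance, isPrecompactGroup_Cp,
    isTAP_Cp_of_denseRange hqd hqc, isStarRegular_of_subset_ultrafilter X _,
    not_isTAP_Cp_Cp hp hq hpo hqo⟩
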